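/- A (real-time) deterministic push-down automaton (DPDA) is a tuple $M=(Q,\Sigma,\Gamma,\delta,\bot)$ with a finite non-empty set $Q$ of states, finite input and stack alphabets $\Sigma,\Gamma$, a bottom symbol $\bot\in\Gamma$, and a total transition function $\delta\colon Q\times\Sigma\times\Gamma\to Q\times\Gamma^*$ such that, whenever $\delta(q,\sigma,x)=(q',\gamma)$ and $\bot$ occurs in $\gamma$, then $x=\bot$ and $\bot$ occurs in $\gamma$ only as its first (lowest) symbol. (Start and final states are irrelevant here.) A configuration is a pair in $Q\times\Gamma^*$, the right end of the stack word being the top; reading $\sigma\in\Sigma$ leads from $(q,\upsilon x)$ with $x\in\Gamma$ to $(q',\upsilon\gamma)$ if $\delta(q,\sigma,x)=(q',\gamma)$, and no transition is possible when the stack word is empty. We write $c\xrightarrow{w}d$ if reading the letters of $w\in\Sigma^*$ one after the other leads from $c$ to $d$. A run in which no transition decreases the stack height (the length of the stack word), or in which no transition increases it, is called a stroke. A word $w\in\Sigma^*$ is an $n$-turn synchronizing word for $M$ in the arbitrary stack model if there is a state $\overline q\in Q$ such that for every $q\in Q$ there is $\upsilon_q\in\Gamma^*$ with $(q,\bot)\xrightarrow{w}(\overline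 q,\upsilon_q)$ and this run is a concatenation of at most $n+1$ strokes. It is one in the same stack model if moreover $\upsilon_q=\upsilon_{q'}$ for all $q,q'\in Q$, and in the empty stack model if moreover $\upsilon_q=\bot$ for all $q\in Q$. The problems $n$-Turn-Sync-DPDA-Empty, $n$-Turn-Sync-DPDA-Same and $n$-Turn-Sync-DPDA-Arb ask, given (a finite description of) a DPDA $M$, whether $M$ has an $n$-turn synchronizing word in the empty, the same, and the arbitrary stack model, respectively. Theorem. Each of the three problems 1-Turn-Sync-DPDA-Empty, 1-Turn-Sync-DPDA-Same and 1-Turn-Sync-DPDA-Arb is undecidable. -/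

import Mathlib

/-- A real-time deterministic push-down automaton with states `Q`, input alphabet `A` and stack
alphabet `Γ`; start and final states play no role for synchronization and are left out.
Stack contents and pushed words are lists whose *head is the top* of the stack, so the lowest
symbol is the last entry. -/
structure DPDA (Q A Γ : Type) where
  /-- The bottom-of-stack symbol. -/
  bot : Γ
  /-- The (total) transition function: the top symbol is replaced by the returned word. -/
  δ : Q → A → Γ → Q × List Γ
  /-- A word written by a transition contains the bottom symbol only as its lowest symbol, and
  only if the symbol that it replaces is the bottom symbol. -/
  bot_lowest : ∀ q a x, bot ∈ (δ q a x).2 → x = bot ∧ bot ∉ (δ q a x).2.dropLast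

namespace DPDA

variable {Q A Γ : Type}

/-- `M.Step a c d`: reading the letter `a` leads from configuration `c` to configuration `d`.
There is no step out of a configuration whose stack content is the empty word. -/
def Step (M : DPDA Q A Γ) (a : A) : Q × List Γ → Q × List Γ → Prop
  | (_, []), _ => False
  | (q, x :: υ), d => d = ((M.δ q a x).1, (M.δ q a x).2 ++ υ)

/-- `M.RunWith R c w d`: reading `w` leads from `c` to `d`, and each single transition on the way
changes the stack height from some `h` to some `h'` with `R h h'`. -/
inductive RunWith (M : DPDA Q A Γ) (R : ℕ → ℕ → Prop) :
    Q × List Γ → List A → Q × List Γ → Prop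
  | nil (c : Q × List Γ) : RunWith M R c [] c
  | cons {c d e : Q × List Γ} {a : A} {w : List A} :
      M.Step a c d → R c.2.length d.2.length → RunWith M R d w e → RunWith M R c (a :: w) e

/-- Reading `w` leads from `c` to `d`. -/
def Run (M : DPDA Q A Γ) (c : Q × List Γ) (w : List A) (d : Q × List Γ) : Prop :=
  M.RunWith (fun _ _ => True) c w d

/-- A run in which no transition decreases the stack height. -/
def Upstroke (M : DPDA Q A Γ) (c : Q × List Γ) (w : List A) (d : Q × List Γ) : Prop :=
  M.RunWith (fun h h' => h ≤ h') c w d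

/-- A run in which no transition increases the stack height. -/
def Downstroke (M : DPDA Q A Γ) (c : Q × List Γ) (w : List A) (d : Q × List Γ) : Prop :=
  M.RunWith (fun h h' => h' ≤ h) c w d

/-- The run from `c` to `d` on the given word is a concatenation of `k` strokes. -/
inductive Strokes (M : DPDA Q A Γ) : ℕ → Q × List Γ → List A → Q × List Γ → Prop
  | zero (c : Q × List Γ) : Strokes M 0 c [] c
  | succ {k : ℕ} {c d e : Q × List Γ} {u v : List A} :
      M.Upstroke c u d ∨ M.Downstroke c u d → Strokes M k d v e → Strokes M (k + 1) c (u ++ v) e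

/-- The requirement on the stack contents at the end of a synchronizing word. -/
inductive StackModel
  | empty
  | same
  | arbitrary

/-- The final stack contents `υ q` of the runs started in the states `q` are as the stack model
requires. -/
def StackModel.Holds (bot : Γ) (υ : Q → List Γ) : StackModel → Prop
  | .empty => ∀ q, υ q = [bot]
  | .same => ∀ q q', υ q = υ q'
  | .arbitrary => True

/-- `w` is an `n`-turn synchronizing word for `M` in the given stack model: the runs on `w` from
all states, started with only the bottom symbol on the stack, exist, end in one common state with
admissible stack contents, and each splits into at most `n + 1` strokes. -/
def IsTurnSyncWord (M : DPDA Q A Γ) (n : ℕ) (m : StackModel) (w : List A) : Prop :=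
  ∃ (p : Q) (υ : Q → List Γ),
    (∀ q, M.Run (q, [M.bot]) w (p, υ q)) ∧ m.Holds M.bot υ ∧
    ∀ q, ∃ k ≤ n + 1, M.Strokes k (q, [M.bot]) w (p, υ q)

end DPDA

/-- The instances of the decision problems: a DPDA with finitely many states, input letters and
stack symbols, numbered `0, 1, 2, …`, and at least one state. -/
structure FinDPDA where
  numStates : ℕ
  numLetters : ℕ
  numStack : ℕ
  numStates_pos : 0 < numStates
  toDPDA : DPDA (Fin numStates) (Fin numLetters) (Fin numStack)

namespace FinDPDA

/-- Finite descriptions of automata: the three sizes, the number of the bottom symbol, and the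
transition table. -/
abbrev Code : Type := ℕ × ℕ × ℕ × ℕ × List (List (List (ℕ × List ℕ)))

/-- The description of an automaton, with its transition table written out row by row. -/
def code (M : FinDPDA) : Code :=
  (M.numStates, M.numLetters, M.numStack, M.toDPDA.bot,
    List.ofFn fun q => List.ofFn fun a => List.ofFn fun x =>
      (((M.toDPDA.δ q a x).1 : ℕ), (M.toDPDA.δ q a x).2.map Fin.val))

/-- Distinct automata have distinct descriptions. -/
theorem code_injective : Function.Injective code := by
  rintro ⟨n, m, k, hn, b, δ, h⟩ ⟨n', m', k', hn', b', δ', h'⟩ e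
  simp only [code, Prod.mk.injEq] at e
  obtain ⟨rfl, rfl, rfl, hb, ht⟩ := e
  obtain rfl := Fin.ext hb
  have : δ = δ' := by
    funext q a x
    have h1 := congrFun (List.ofFn_injective
      (congrFun (List.ofFn_injective (congrFun (List.ofFn_injective ht) q)) a)) x
    simp only [Prod.mk.injEq] at h1
    exact Prod.ext (Fin.ext h1.1) (List.map_injective_iff.2 Fin.val_injective h1.2)
  subst this
  rfl

/-- The question of the `n`-turn synchronization problem in the given stack model. -/
def TurnSync (n : ℕ) (m : DPDA.StackModel) (M : FinDPDA) : Prop :=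
  ∃ w, M.toDPDA.IsTurnSyncWord n m w

/-- A decision problem about automata is decidable if some algorithm answers it correctly on the
description of every automaton (what it answers on other inputs is irrelevant). -/
def IsDecidable (P : FinDPDA → Prop) : Prop :=
  ∃ D : Code → Prop, ComputablePred D ∧ ∀ M : FinDPDA, D M.code ↔ P M

end FinDPDA

/-! The halting problem reduces to all three problems at once, by way of queue automata. If a queue
automaton starts in `p₀` with queue `u` and removes the symbols `s` until its queue is empty, then
everything that was ever in the queue has been removed in order, so `u ++ out p₀ s = s`. Conversely,
any solution `s` of this equation loses its first symbol with every step from a nonempty queue, so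
it bounds the length of the computation. A queue automaton can rotate the two halves of a tape
through its queue and so simulate a Turing machine (`Turing.TM0.exists_empties_iff`).

The equation is tested on the word `reset s turn s.reverse finish` by runs that share the input.
From `record`, the word read is pushed and then popped, which forces the second half to be the
reversal of the first. From `simulate p₀`, `u` and then the outputs are pushed, which forces the
second half to be the reversal of `u ++ out p₀ s`. Each run climbs and then descends, hence one
turn. Since `done` is a sink, synchronization can only happen there.

A solution gives a synchronizing word with stack `bot`, as in the strictest model. A synchronizing
word gives a solution without regard to turns or final stacks. So one reduction serves every model
(`DPDA.exists_isTurnSyncWord_sync_iff`). A single Turing machine with varying input suffices, and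
then only the word `u` in the transition table varies, which makes the reduction computable. -/

open Turing StateTransition

/-! ### Computability of binary representations -/

namespace Turing.PartrecToTM2

/-- Peeling off the lowest digit expresses the digits of `n` by those of `n / 2`, which suits
course-of-values recursion. -/
theorem trNat_eq_cons {n : ℕ} (hn : n ≠ 0) :
    trNat n = (if n % 2 = 0 then Γ'.bit0 else Γ'.bit1) :: trNat (n / 2) := by
  have h0 : ∀ m : ℕ, m ≠ 0 → trNat (2 * m) = Γ'.bit0 :: trNat m := by
    intro m hm
    have e : ((2 * m : ℕ) : Num) = Num.bit0 (m : Num) := by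
      apply Num.to_nat_inj.1
      simp [two_mul]
    obtain ⟨p, hp⟩ : ∃ p, (m : Num) = Num.pos p := by
      cases h : (m : Num) with
      | zero =>
        have := congrArg (fun x : Num => (x : ℕ)) h
        simp at this
        exact absurd this hm
      | pos p => exact ⟨p, rfl⟩
    rw [trNat, trNat, e, hp]
    rfl
  have h1 : ∀ m : ℕ, trNat (2 * m + 1) = Γ'.bit1 :: trNat m := by
    intro m
    have e : ((2 * m + 1 : ℕ) : Num) = Num.bit1 (m : Num) := by
      apply Num.to_nat_inj.1
      simp [two_mul]
    rw [trNat, trNat, e]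
    cases (m : Num) <;> rfl
  rcases Nat.mod_two_eq_zero_or_one n with h | h
  · rw [if_pos h]
    conv_lhs => rw [show n = 2 * (n / 2) by omega]
    exact h0 _ (by omega)
  · rw [if_neg (by omega)]
    conv_lhs => rw [show n = 2 * (n / 2) + 1 by omega]
    exact h1 _

/-- The binary representation of a number, with arbitrary digits, is primitive recursive. -/
theorem primrec_map_trNat (g : Γ' → ℕ) : Primrec fun n => (trNat n).map g := by
  have key : Primrec₂ fun (_ : Unit) (n : ℕ) => (trNat n).map g := by
    refine Primrec.nat_strong_rec _
      -- The list `l` holds the values at all smaller arguments, so its length is the current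
      -- argument.
      (g := fun _ l => if l.length = 0 then some [] else
        (l[l.length / 2]?).map fun t =>
          (if l.length % 2 = 0 then g Γ'.bit0 else g Γ'.bit1) :: t) ?_ ?_
    · have hl : Primrec fun p : Unit × List (List ℕ) => p.2.length :=
        Primrec.list_length.comp Primrec.snd
      refine Primrec.ite (Primrec.eq.comp hl (Primrec.const 0)) (Primrec.const _) ?_
      refine Primrec.option_map
        (Primrec.list_getElem?.comp Primrec.snd (Primrec.nat_div.comp hl (Primrec.const 2))) ?_
      refine Primrec.list_cons.comp (Primrec.ite (Primrec.eq.comp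
        (Primrec.nat_mod.comp (hl.comp Primrec.fst) (Primrec.const 2)) (Primrec.const 0))
        (Primrec.const _) (Primrec.const _)) Primrec.snd
    · intro _ n
      rcases Nat.eq_zero_or_pos n with rfl | hn
      · simp
      · have h2 : n / 2 < n := Nat.div_lt_self hn one_lt_two
        simp only [List.length_map, List.length_range, hn.ne', if_false]
        rw [trNat_eq_cons hn.ne']
        simp [h2]
        split <;> rfl
  exact key.comp (Primrec.const ()) Primrec.id

end Turing.PartrecToTM2

/-! ### A fixed finite Turing machine with undecidable halting problem -/

namespace Turing.TM0

theorem eval_dom_iff {Γ Λ : Type} [Inhabited Γ] [Inhabited Λ] (M : Machine Γ Λ) (l : List Γ) :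
    (TM0.eval M l).Dom ↔ ∃ c, StateTransition.Reaches (step M) (init l) c ∧ step M c = none := by
  have : (TM0.eval M l).Dom ↔ (StateTransition.eval (step M) (init l)).Dom := Iff.rfl
  rw [this, Part.dom_iff_mem]
  simp only [mem_eval]

/-- A Turing machine supported on a finite set of states can be replaced by one whose type of
states is finite. -/
theorem exists_finite_states {Γ Λ : Type} [Inhabited Γ] [Inhabited Λ] (M : Machine Γ Λ)
    (S : Finset Λ) (hS : Supports M (S : Set Λ)) :
    ∃ (Λ' : Type) (_ : Inhabited Λ') (_ : Finite Λ') (M' : Machine Γ Λ'),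
      ∀ l, (TM0.eval M' l).Dom ↔ (TM0.eval M l).Dom := by
  classical
  let _ : Inhabited {q // q ∈ S} := ⟨⟨default, hS.1⟩⟩
  -- States outside `S` may be sent anywhere, as `Supports` keeps runs inside `S`.
  let g₁ : PointedMap Λ {q // q ∈ S} :=
    ⟨fun q => if h : q ∈ S then ⟨q, h⟩ else default, by
      have : (default : Λ) ∈ S := hS.1
      simp [this]; rfl⟩
  let f : PointedMap Γ Γ := ⟨id, rfl⟩
  refine ⟨{q // q ∈ S}, inferInstance, inferInstance, M.map f f g₁ Subtype.val, fun l => ?_⟩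
  have hr := Machine.map_respects M f f g₁ Subtype.val hS (fun _ => rfl) (by
    intro q hq
    have : q ∈ S := hq
    change Subtype.val (if h : q ∈ S then (⟨q, h⟩ : {q // q ∈ S}) else default) = q
    simp [this])
  have hi : (init l : Cfg Γ Λ).map f g₁ = init l := by
    rw [map_init f g₁ l]
    exact congrArg _ (List.map_id l)
  exact tr_eval_dom hr ⟨hS.1, hi⟩

/-- There is a finite Turing machine, and a computable sequence of inputs for it, such that the
halting problem of the machine on these inputs is undecidable. -/
theorem exists_undecidable_halting :
    ∃ (Γ Λ : Type) (_ : Inhabited Γ) (_ : Inhabited Λ) (_ : Finite Γ) (_ : Finite Λ)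
      (M : Machine Γ Λ) (a : Γ) (l : ℕ → List Γ),
      (∀ g : Γ → ℕ, Primrec fun n => (l n).map g) ∧
      ¬ ComputablePred fun n => (TM0.eval M (a :: l n)).Dom := by
  -- A universal program: on input `n` it runs the `n`-th code on `0`.
  obtain ⟨c, hc⟩ := ToPartrec.Code.exists_code (Nat.Partrec'.part_iff₁.2
    (show Partrec fun n : ℕ => (Nat.Partrec.Code.eval (Denumerable.ofNat Nat.Partrec.Code n) 0) from
      Nat.Partrec.Code.eval_part.comp (Computable.ofNat _) (Computable.const 0)))
  have hc' : ∀ n, (c.eval [n]).Dom ↔ (Nat.Partrec.Code.eval (Denumerable.ofNat _ n) 0).Dom := by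
    intro n
    have := hc ⟨[n], rfl⟩
    rw [this]
    rfl
  -- Machines start in the default state, so this instance makes them run `c`.
  let _ : Inhabited PartrecToTM2.Λ' := ⟨PartrecToTM2.trNormal c PartrecToTM2.Cont'.halt⟩
  let M1 := TM2to1.tr PartrecToTM2.tr
  let M0 := TM1to0.tr M1
  have hs := TM1to0.tr_supports M1 (TM2to1.tr_supports PartrecToTM2.tr
    (PartrecToTM2.tr_supports c PartrecToTM2.Cont'.halt))
  obtain ⟨Λ, i1, i2, M, hM⟩ := exists_finite_states M0 _ hs
  let sym : PartrecToTM2.Γ' → TM2to1.Γ' PartrecToTM2.K' (fun _ => PartrecToTM2.Γ') := fun a =>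
    (false, Function.update (fun _ => none) PartrecToTM2.K'.main (some a))
  have hK : Finite PartrecToTM2.K' := Finite.of_surjective
    (fun i : Fin 4 => match i with
      | 0 => PartrecToTM2.K'.main | 1 => .rev | 2 => .aux | 3 => .stack) (by
      intro k
      cases k
      exacts [⟨0, rfl⟩, ⟨1, rfl⟩, ⟨2, rfl⟩, ⟨3, rfl⟩])
  have hΓ : Finite (TM2to1.Γ' PartrecToTM2.K' (fun _ => PartrecToTM2.Γ')) := by
    unfold TM2to1.Γ'
    infer_instance
  refine ⟨TM2to1.Γ' PartrecToTM2.K' (fun _ => PartrecToTM2.Γ'), Λ, inferInstance, i1, hΓ, i2, M,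
    -- The flag `true` marks the stack bottom. The bottom symbol is the end marker `cons` of the
    -- number, so the first cell does not depend on `n`.
    (true, (sym .cons).2), fun n => (PartrecToTM2.trNat n).reverse.map sym, fun g => ?_, ?_⟩
  · have := (Primrec.list_reverse.comp (PartrecToTM2.primrec_map_trNat (g ∘ sym)))
    refine this.of_eq fun n => ?_
    simp
  · intro h
    refine ComputablePred.halting_problem 0 ?_
    refine ComputablePred.computable_of_manyOneReducible
      ⟨Encodable.encode, Computable.encode, fun k => ?_⟩ h
    have e : ((true, (sym .cons).2) :: (PartrecToTM2.trNat (Encodable.encode k)).reverse.map sym)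
        = TM2to1.trInit PartrecToTM2.K'.main (PartrecToTM2.trList [Encodable.encode k]) := by
      have hr : (PartrecToTM2.trList [Encodable.encode k]).reverse =
          .cons :: (PartrecToTM2.trNat (Encodable.encode k)).reverse := by
        simp
      unfold TM2to1.trInit
      rw [hr]
      rfl
    have h2 : (TM2.eval PartrecToTM2.tr PartrecToTM2.K'.main
        (PartrecToTM2.trList [Encodable.encode k])).Dom ↔
        (StateTransition.eval (TM2.step PartrecToTM2.tr)
          (PartrecToTM2.init c [Encodable.encode k])).Dom := by
      have : (TM2.init PartrecToTM2.K'.main (PartrecToTM2.trList [Encodable.encode k])) =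
          PartrecToTM2.init c [Encodable.encode k] := by
        unfold TM2.init PartrecToTM2.init
        congr 1
        funext x
        cases x <;> rfl
      rw [← this]
      rfl
    have h3 : (TM0.eval M0 (TM2to1.trInit PartrecToTM2.K'.main
        (PartrecToTM2.trList [Encodable.encode k]))).Dom ↔ (Nat.Partrec.Code.eval k 0).Dom := by
      rw [TM1to0.tr_eval]
      refine (TM2to1.tr_eval_dom PartrecToTM2.tr _ _).trans (h2.trans ?_)
      rw [PartrecToTM2.tr_eval]
      refine Iff.trans ?_ ((hc' (Encodable.encode k)).trans ?_)
      · simp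
      · rw [Denumerable.ofNat_encode]
    exact (((hM _).trans (iff_of_eq (congrArg (fun l => (TM0.eval M0 l).Dom) e))).trans h3).symm

end Turing.TM0

/-! ### Queue automata and the equation for emptying the queue -/

/-- A queue automaton: in state `p`, the first symbol `x` of the queue is removed, the word
`(next p x).2` is appended to the queue, and the state changes to `(next p x).1`. -/
structure QueueAutomaton (P S : Type) where
  next : P → S → P × List S

namespace QueueAutomaton

variable {P S : Type} (A : QueueAutomaton P S)

/-- The word appended to the queue while the symbols of the given word are removed. -/
def out : P → List S → List S
  | _, [] => []
  | p, x :: s => (A.next p x).2 ++ out (A.next p x).1 s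

/-- `s` is the sequence of the symbols removed on a run from `c` to the empty queue. -/
def Empties (c : P × List S) (s : List S) : Prop :=
  c.2 ++ A.out c.1 s = s

/-- A single step between configurations. -/
inductive Step : P × List S → P × List S → Prop
  | pop (p : P) (x : S) (v : List S) :
      Step (p, x :: v) ((A.next p x).1, v ++ (A.next p x).2)

variable {A}

/-- The queue is nonempty, so `s` begins with its first symbol, and this symbol cancels in the
equation. The strict decrease will bound the number of steps. -/
theorem Step.exists_empties {c d : P × List S} (h : A.Step c d) {s : List S}
    (hs : A.Empties c s) : ∃ t, A.Empties d t ∧ t.length < s.length := by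
  obtain ⟨p, x, v⟩ := h
  cases s with
  | nil => simp [Empties] at hs
  | cons y s =>
    simp only [Empties, List.cons_append, List.cons.injEq] at hs
    obtain ⟨rfl, hs⟩ := hs
    exact ⟨s, by simpa [Empties, out] using hs, by simp⟩

theorem Step.empties_of {c d : P × List S} (h : A.Step c d) {t : List S}
    (ht : A.Empties d t) : ∃ s, A.Empties c s := by
  obtain ⟨p, x, v⟩ := h
  exact ⟨x :: t, by simpa [Empties, out] using ht⟩

theorem exists_empties_of_transGen {c d : P × List S} (h : Relation.TransGen A.Step c d) :
    ∀ {s : List S}, A.Empties c s → ∃ t, A.Empties d t ∧ t.length < s.length := by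
  induction h with
  | single h => exact fun hs => h.exists_empties hs
  | tail _ h ih =>
    intro s hs
    obtain ⟨t, ht, hl⟩ := ih hs
    obtain ⟨u, hu, hl'⟩ := h.exists_empties ht
    exact ⟨u, hu, hl'.trans hl⟩

theorem empties_of_transGen {c d : P × List S} (h : Relation.TransGen A.Step c d) :
    (∃ t, A.Empties d t) → ∃ s, A.Empties c s := by
  induction h with
  | single h => exact fun ⟨t, ht⟩ => h.empties_of ht
  | tail _ h ih => exact fun ⟨t, ht⟩ => ih (h.empties_of ht)

theorem step_of_next {p q : P} {x : S} {w : List S} (h : A.next p x = (q, w)) (v : List S) :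
    A.Step (p, x :: v) (q, v ++ w) := by
  have := Step.pop (A := A) p x v
  rwa [h] at this

/-- A state that copies the symbols of `w` rotates the queue by `w`. -/
theorem reflTransGen_rotate {p : P} {w : List S} (h : ∀ x ∈ w, A.next p x = (p, [x]))
    (v : List S) : Relation.ReflTransGen A.Step (p, w ++ v) (p, v ++ w) := by
  induction w generalizing v with
  | nil => simpa using Relation.ReflTransGen.refl
  | cons x w ih =>
    refine Relation.ReflTransGen.head (step_of_next (h x (by simp)) _) ?_
    simpa using ih (fun y hy => h y (by simp [hy])) (v ++ [x])

/-- A state that copies the symbols of `w` and then acts on the symbol `x` behind `w`. -/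
theorem transGen_rotate_step {p q : P} {w : List S} (h : ∀ x ∈ w, A.next p x = (p, [x]))
    {x : S} {u : List S} (hx : A.next p x = (q, u)) (v : List S) :
    Relation.TransGen A.Step (p, w ++ x :: v) (q, v ++ (w ++ u)) := by
  refine Relation.TransGen.tail' (reflTransGen_rotate h (x :: v)) ?_
  simpa using step_of_next hx (v ++ w)

end QueueAutomaton

/-! ### Simulation of a Turing machine by a queue automaton -/

namespace Turing.TM0

/-- The queue alphabet for the simulation of a Turing machine: the part of the tape to the left of
the head, read from the head outwards, is followed by `sep`, and the part to the right, again read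
from the head outwards, by `last`. -/
inductive QSymbol (Γ : Type)
  | sym (a : Γ)
  | sep
  | last

/-- The states of the queue automaton that simulates a Turing machine. -/
inductive QState (Γ Λ : Type)
  /-- The Turing machine is in state `q` and scans `a`; the queue holds the rest of the tape. -/
  | scan (q : Λ) (a : Γ)
  /-- Copy the left part, then the right part; then scan `a` in state `q`. -/
  | copyLeft (q : Λ) (a : Γ)
  /-- Copy the right part, then scan `a` in state `q`. -/
  | copyRight (q : Λ) (a : Γ)
  /-- Copy the left part, then remove the scanned symbol from the right part. -/
  | moveRight (q : Λ)
  /-- Remove the scanned symbol from the right part. -/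
  | popRight (q : Λ)
  /-- Remove the scanned symbol from the left part, and add `b` to the right part. -/
  | popLeft (q : Λ) (b : Γ)
  /-- Copy the left part, and add `b` to the right part; then scan `a` in state `q`. -/
  | moveLeft (q : Λ) (a b : Γ)
  /-- Empty the queue. -/
  | erase

variable {Γ Λ : Type}

instance [Finite Γ] : Finite (QSymbol Γ) :=
  Finite.of_surjective (Sum.elim ![.sep, .last] .sym) fun
    | .sym a => ⟨.inr a, rfl⟩
    | .sep => ⟨.inl 0, rfl⟩
    | .last => ⟨.inl 1, rfl⟩

instance [Finite Γ] [Finite Λ] [Inhabited Γ] [Inhabited Λ] : Finite (QState Γ Λ) :=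
  Finite.of_surjective (fun x : Fin 8 × Λ × Γ × Γ =>
      ![.scan x.2.1 x.2.2.1, .copyLeft x.2.1 x.2.2.1, .copyRight x.2.1 x.2.2.1, .moveRight x.2.1,
        .popRight x.2.1, .popLeft x.2.1 x.2.2.2, .moveLeft x.2.1 x.2.2.1 x.2.2.2, .erase] x.1) fun
    | .scan q a => ⟨(0, q, a, default), rfl⟩
    | .copyLeft q a => ⟨(1, q, a, default), rfl⟩
    | .copyRight q a => ⟨(2, q, a, default), rfl⟩
    | .moveRight q => ⟨(3, q, default, default), rfl⟩
    | .popRight q => ⟨(4, q, default, default), rfl⟩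
    | .popLeft q b => ⟨(5, q, default, b), rfl⟩
    | .moveLeft q a b => ⟨(6, q, a, b), rfl⟩
    | .erase => ⟨(7, default, default, default), rfl⟩

/-- The transitions of the simulation in all states but `QState.scan`. -/
def queueCopy [Inhabited Γ] : QState Γ Λ → QSymbol Γ → QState Γ Λ × List (QSymbol Γ)
  | .copyLeft q a, .sym x => (.copyLeft q a, [.sym x])
  | .copyLeft q a, .sep => (.copyRight q a, [.sep])
  | .copyRight q a, .sym x => (.copyRight q a, [.sym x])
  | .copyRight q a, .last => (.scan q a, [.last])
  | .moveRight q, .sym x => (.moveRight q, [.sym x])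
  | .moveRight q, .sep => (.popRight q, [.sep])
  | .popRight q, .sym x => (.copyRight q x, [])
  | .popRight q, .last => (.scan q default, [.last])
  | .popLeft q b, .sym x => (.moveLeft q x b, [])
  | .popLeft q b, .sep => (.copyRight q default, [.sep, .sym b])
  | .moveLeft q a b, .sym x => (.moveLeft q a b, [.sym x])
  | .moveLeft q a b, .sep => (.copyRight q a, [.sep, .sym b])
  | _, _ => (.erase, [])

variable [Inhabited Γ] [Inhabited Λ]

/-- The queue automaton that simulates a Turing machine and empties its queue when the Turing
machine halts. -/
def queueAutomaton (M : Machine Γ Λ) : QueueAutomaton (QState Γ Λ) (QSymbol Γ) where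
  next
    | .scan q a, y =>
      match M q a with
      | none => (.erase, [])
      | some (q', .write b) => queueCopy (.copyLeft q' b) y
      | some (q', .move .right) =>
        ((queueCopy (.moveRight q') y).1, .sym a :: (queueCopy (.moveRight q') y).2)
      | some (q', .move .left) => queueCopy (.popLeft q' a) y
    | p, y => queueCopy p y

/-- The queue that represents a tape. -/
def queueOf (L R : List Γ) : List (QSymbol Γ) :=
  L.map .sym ++ .sep :: (R.map .sym ++ [.last])

theorem transGen_copyRight (M : Machine Γ Λ) (q : Λ) (a : Γ) (R : List Γ)
    (v : List (QSymbol Γ)) :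
    Relation.TransGen (queueAutomaton M).Step (.copyRight q a, R.map .sym ++ .last :: v)
      (.scan q a, v ++ (R.map .sym ++ [.last])) :=
  QueueAutomaton.transGen_rotate_step (by simp [queueAutomaton, queueCopy]) rfl v

/-- The state `scan` already consumes a queue symbol, which is `sep` if the left part is empty. This
case therefore skips the copying of the left part, here and for both moves. -/
theorem transGen_write {M : Machine Γ Λ} {q q' : Λ} {a b : Γ}
    (h : M q a = some (q', .write b)) (L R : List Γ) :
    Relation.TransGen (queueAutomaton M).Step (.scan q a, queueOf L R)
      (.scan q' b, queueOf L R) := by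
  have hn : ∀ y, (queueAutomaton M).next (.scan q a) y = queueCopy (.copyLeft q' b) y := by
    intro y
    simp [queueAutomaton, h]
  have hc := transGen_copyRight M q' b R
  cases L with
  | nil =>
    refine Relation.TransGen.head (QueueAutomaton.step_of_next (hn _) _) ?_
    simpa [queueOf] using hc [.sep]
  | cons x L =>
    refine Relation.TransGen.head (QueueAutomaton.step_of_next (hn _) _) ?_
    have h1 := QueueAutomaton.transGen_rotate_step (A := queueAutomaton M)
      (p := .copyLeft q' b) (q := .copyRight q' b) (w := L.map .sym) (x := .sep)
      (by simp [queueAutomaton, queueCopy]) rfl (R.map .sym ++ [.last] ++ [.sym x])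
    have h2 := hc (.sym x :: (L.map .sym ++ [.sep]))
    simpa [queueOf] using h1.trans (by simpa using h2)

/-- The old symbol `a` is appended before anything is copied, so after the full rotation it heads
the left part. -/
theorem transGen_moveRight {M : Machine Γ Λ} {q q' : Λ} {a : Γ}
    (h : M q a = some (q', .move .right)) (L R : List Γ) :
    Relation.TransGen (queueAutomaton M).Step (.scan q a, queueOf L R)
      (.scan q' R.headI, queueOf (a :: L) R.tail) := by
  have hn : ∀ y, (queueAutomaton M).next (.scan q a) y =
      ((queueCopy (.moveRight q') y).1, .sym a :: (queueCopy (.moveRight q') y).2) := by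
    intro y
    simp [queueAutomaton, h]
  have hp : ∀ v, Relation.TransGen (queueAutomaton M).Step
      (.popRight q', R.map .sym ++ .last :: v)
      (.scan q' R.headI, v ++ (R.tail.map .sym ++ [.last])) := by
    intro v
    cases R with
    | nil =>
      exact Relation.TransGen.single (QueueAutomaton.step_of_next rfl _)
    | cons x R =>
      refine Relation.TransGen.head (QueueAutomaton.step_of_next (q := .copyRight q' x) rfl _) ?_
      simpa using transGen_copyRight M q' x R v
  cases L with
  | nil =>
    refine Relation.TransGen.head (QueueAutomaton.step_of_next (hn _) _) ?_
    simpa [queueOf, queueCopy] using hp [.sym a, .sep]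
  | cons x L =>
    refine Relation.TransGen.head (QueueAutomaton.step_of_next (hn _) _) ?_
    have h1 := QueueAutomaton.transGen_rotate_step (A := queueAutomaton M)
      (p := .moveRight q') (q := .popRight q') (w := L.map .sym) (x := .sep)
      (by simp [queueAutomaton, queueCopy]) rfl (R.map .sym ++ [.last] ++ [.sym a, .sym x])
    have h2 := hp (.sym a :: .sym x :: (L.map .sym ++ [.sep]))
    simpa [queueOf, queueCopy] using h1.trans (by simpa using h2)

/-- The old symbol `a` is appended directly behind `sep`, so it heads the right part. -/
theorem transGen_moveLeft {M : Machine Γ Λ} {q q' : Λ} {a : Γ}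
    (h : M q a = some (q', .move .left)) (L R : List Γ) :
    Relation.TransGen (queueAutomaton M).Step (.scan q a, queueOf L R)
      (.scan q' L.headI, queueOf L.tail (a :: R)) := by
  have hn : ∀ y, (queueAutomaton M).next (.scan q a) y = queueCopy (.popLeft q' a) y := by
    intro y
    simp [queueAutomaton, h]
  cases L with
  | nil =>
    refine Relation.TransGen.head (QueueAutomaton.step_of_next (hn _) _) ?_
    have h2 := QueueAutomaton.transGen_rotate_step (A := queueAutomaton M)
      (p := .copyRight q' default) (q := .scan q' default) (w := R.map .sym) (x := .last)
      (by simp [queueAutomaton, queueCopy]) rfl [.sep, .sym a]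
    simpa [queueOf, queueCopy] using h2
  | cons x L =>
    refine Relation.TransGen.head (QueueAutomaton.step_of_next (hn _) _) ?_
    have h1 := QueueAutomaton.transGen_rotate_step (A := queueAutomaton M)
      (p := .moveLeft q' x a) (q := .copyRight q' x) (w := L.map .sym) (x := .sep)
      (by simp [queueAutomaton, queueCopy]) rfl (R.map .sym ++ [.last])
    have h2 := transGen_copyRight M q' x R (L.map .sym ++ [.sep, .sym a])
    simpa [queueOf, queueCopy] using h1.trans (by simpa using h2)

theorem exists_transGen_of_step {M : Machine Γ Λ} {q : Λ} {a : Γ} {L R : List Γ}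
    {c : Cfg Γ Λ} (h : step M ⟨q, ⟨a, ListBlank.mk L, ListBlank.mk R⟩⟩ = some c) :
    ∃ q' a' L' R', c = ⟨q', ⟨a', ListBlank.mk L', ListBlank.mk R'⟩⟩ ∧
      Relation.TransGen (queueAutomaton M).Step (.scan q a, queueOf L R)
        (.scan q' a', queueOf L' R') := by
  simp only [step, Option.map_eq_some_iff] at h
  obtain ⟨⟨q', s⟩, hM, rfl⟩ := h
  rcases s with (_ | _) | b
  · exact ⟨q', _, _, _, rfl, transGen_moveLeft hM L R⟩
  · exact ⟨q', _, _, _, rfl, transGen_moveRight hM L R⟩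
  · exact ⟨q', _, _, _, rfl, transGen_write hM L R⟩

theorem exists_empties_erase (M : Machine Γ Λ) (v : List (QSymbol Γ)) :
    ∃ s, (queueAutomaton M).Empties (.erase, v) s := by
  have h : ∀ s, (queueAutomaton M).out .erase s = [] := by
    intro s
    induction s with
    | nil => rfl
    | cons x s ih => simpa [QueueAutomaton.out, queueAutomaton, queueCopy] using ih
  exact ⟨v, by simp [QueueAutomaton.Empties, h]⟩

theorem exists_empties_of_step_eq_none {M : Machine Γ Λ} {q : Λ} {T : Tape Γ}
    (h : step M ⟨q, T⟩ = none) (L R : List Γ) :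
    ∃ s, (queueAutomaton M).Empties (.scan q T.head, queueOf L R) s := by
  have hM : M q T.head = none := by simpa [step] using h
  have hn : ∀ y, (queueAutomaton M).next (.scan q T.head) y = (.erase, []) := by
    intro y
    simp [queueAutomaton, hM]
  have hs : ∀ y v, ∃ s, (queueAutomaton M).Empties (.scan q T.head, y :: v) s := fun y v =>
    have ⟨_, ht⟩ := exists_empties_erase M (v ++ [])
    (QueueAutomaton.step_of_next (hn y) v).empties_of ht
  cases L <;> exact hs _ _

/-- The queue automaton empties its queue if and only if the Turing machine halts. -/
theorem exists_empties_iff (M : Machine Γ Λ) (a : Γ) (l : List Γ) :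
    (∃ s, (queueAutomaton M).Empties (.scan default a, queueOf [] l) s) ↔
      (TM0.eval M (a :: l)).Dom := by
  rw [eval_dom_iff]
  have hi : (init (a :: l) : Cfg Γ Λ) = ⟨default, ⟨a, ListBlank.mk [], ListBlank.mk l⟩⟩ := rfl
  rw [hi]
  clear hi
  generalize (default : Λ) = q, ([] : List Γ) = L
  constructor
  · rintro ⟨s, hs⟩
    -- Each step of the machine takes at least one queue step and so shortens the emptying sequence;
    -- hence the machine halts.
    induction hn : s.length using Nat.strong_induction_on generalizing q a L l s with
    | _ n ih =>
      cases hc : step M ⟨q, ⟨a, ListBlank.mk L, ListBlank.mk l⟩⟩ with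
      | none => exact ⟨_, Relation.ReflTransGen.refl, hc⟩
      | some c =>
        obtain ⟨q', a', L', R', rfl, ht⟩ := exists_transGen_of_step hc
        obtain ⟨t, ht, hl⟩ := QueueAutomaton.exists_empties_of_transGen ht hs
        obtain ⟨d, hd, hd'⟩ := ih _ (hn ▸ hl) a' R' q' L' t ht rfl
        exact ⟨d, Relation.ReflTransGen.head hc hd, hd'⟩
  · rintro ⟨d, hd, hd'⟩
    generalize hc : (⟨q, ⟨a, ListBlank.mk L, ListBlank.mk l⟩⟩ : Cfg Γ Λ) = c at hd
    induction hd using Relation.ReflTransGen.head_induction_on generalizing q a L l with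
    | refl =>
      subst hc
      exact exists_empties_of_step_eq_none hd' L l
    | head h _ ih =>
      subst hc
      obtain ⟨q', a', L', R', rfl, ht⟩ := exists_transGen_of_step h
      exact QueueAutomaton.empties_of_transGen ht (ih _ _ _ _ rfl)

end Turing.TM0

/-! ### Runs and strokes -/

namespace DPDA

variable {Q A Γ : Type} {M : DPDA Q A Γ}

theorem RunWith.mono {R R' : ℕ → ℕ → Prop} (h : ∀ i j, R i j → R' i j) {c d : Q × List Γ}
    {w : List A} (hw : M.RunWith R c w d) : M.RunWith R' c w d := by
  induction hw with
  | nil => exact .nil _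
  | cons hs hR _ ih => exact .cons hs (h _ _ hR) ih

theorem RunWith.append {R : ℕ → ℕ → Prop} {c d e : Q × List Γ} {u v : List A}
    (hu : M.RunWith R c u d) (hv : M.RunWith R d v e) : M.RunWith R c (u ++ v) e := by
  induction hu with
  | nil => exact hv
  | cons hs hR _ ih => exact .cons hs hR (ih hv)

theorem Strokes.run {k : ℕ} {c d : Q × List Γ} {w : List A} (h : M.Strokes k c w d) :
    M.Run c w d := by
  induction h with
  | zero => exact .nil _
  | succ h _ ih =>
    refine RunWith.append ?_ ih
    rcases h with h | h <;> exact h.mono fun _ _ _ => trivial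

theorem strokes_two {c d e : Q × List Γ} {u v : List A} (hu : M.Upstroke c u d)
    (hv : M.Downstroke d v e) : M.Strokes 2 c (u ++ v) e := by
  have h := Strokes.succ (Or.inl hu) (Strokes.succ (Or.inr hv) (Strokes.zero e))
  rwa [List.append_nil] at h

theorem run_nil_iff {c d : Q × List Γ} : M.Run c [] d ↔ c = d := by
  constructor
  · rintro ⟨⟩
    rfl
  · rintro rfl
    exact .nil _

theorem run_cons_iff {q : Q} {x : Γ} {υ : List Γ} {a : A} {w : List A} {d : Q × List Γ} :
    M.Run (q, x :: υ) (a :: w) d ↔ M.Run ((M.δ q a x).1, (M.δ q a x).2 ++ υ) w d := by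
  constructor
  · rintro (_ | ⟨hs, _, hr⟩)
    cases hs
    exact hr
  · exact fun h => .cons rfl trivial h

theorem RunWith.cons_of_δ {R : ℕ → ℕ → Prop} {q q' : Q} {x : Γ} {υ γ : List Γ} {a : A}
    {w : List A} {d : Q × List Γ} (hδ : M.δ q a x = (q', γ))
    (hR : R (υ.length + 1) (γ.length + υ.length)) (h : M.RunWith R (q', γ ++ υ) w d) :
    M.RunWith R (q, x :: υ) (a :: w) d := by
  refine .cons (d := (q', γ ++ υ)) ?_ ?_ h
  · simp [Step, hδ]
  · simpa using hR

/-! ### The synchronizing automaton -/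

/-- The states of the automaton that synchronizes if and only if a queue automaton empties its
queue. -/
inductive SyncState (P : Type)
  /-- The sink in which all runs end. -/
  | done
  /-- Reached when the input is malformed. -/
  | trap
  /-- Compare the input with the stack. -/
  | check
  /-- Push the input. -/
  | record
  /-- Simulate the queue automaton, and push the symbols that it appends. -/
  | simulate (p : P)

/-- The input letters of the synchronizing automaton. -/
inductive SyncLetter (S : Type)
  | reset
  | read (x : S)
  | turn
  | finish

/-- The stack symbols of the synchronizing automaton. -/
inductive SyncStack (S : Type)
  | bot
  | mark
  | sym (x : S)

section Sync

variable {P S : Type}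

instance : Nonempty (SyncState P) := ⟨.done⟩

instance [Finite P] : Finite (SyncState P) :=
  Finite.of_surjective (Sum.elim ![.done, .trap, .check, .record] .simulate) fun
    | .done => ⟨.inl 0, rfl⟩
    | .trap => ⟨.inl 1, rfl⟩
    | .check => ⟨.inl 2, rfl⟩
    | .record => ⟨.inl 3, rfl⟩
    | .simulate p => ⟨.inr p, rfl⟩

instance [Finite S] : Finite (SyncLetter S) :=
  Finite.of_surjective (Sum.elim ![.reset, .turn, .finish] .read) fun
    | .reset => ⟨.inl 0, rfl⟩
    | .read x => ⟨.inr x, rfl⟩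
    | .turn => ⟨.inl 1, rfl⟩
    | .finish => ⟨.inl 2, rfl⟩

instance [Finite S] : Finite (SyncStack S) :=
  Finite.of_surjective (Sum.elim ![.bot, .mark] .sym) fun
    | .bot => ⟨.inl 0, rfl⟩
    | .mark => ⟨.inl 1, rfl⟩
    | .sym x => ⟨.inr x, rfl⟩

variable (B : QueueAutomaton P S) (p₀ : P) (u : List S)

/-- The words of stack symbols that represent words. -/
abbrev symStack (l : List S) : List (SyncStack S) := l.map .sym ++ [.mark, .bot]

/-- Transitions of the synchronizing automaton at the bottom of the stack. -/
def syncBot : SyncState P → SyncLetter S → SyncState P × List (SyncStack S)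
  | .done, _ => (.done, [.bot])
  | .record, .reset => (.record, symStack [])
  | _, .reset => (.simulate p₀, symStack u.reverse)
  | q, _ => (q, [.bot])

open Classical in
/-- Transitions of the synchronizing automaton above the bottom of the stack. -/
noncomputable def syncTop :
    SyncState P → SyncLetter S → SyncStack S → SyncState P × List (SyncStack S)
  | .done, _, y => (.done, [y])
  | .simulate p, .read x, y => (.simulate (B.next p x).1, (B.next p x).2.reverse.map .sym ++ [y])
  | .simulate _, .turn, y => (.check, [y])
  | .record, .read x, y => (.record, [.sym x, y])
  | .record, .turn, y => (.check, [y])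
  | .check, .read x, .sym y => if x = y then (.check, []) else (.trap, [.sym y])
  | .check, .finish, .mark => (.done, [])
  | _, _, y => (.trap, [y])

/-- The automaton that has a synchronizing word if and only if the queue automaton, started in the
state `p₀` with the queue `u`, empties its queue. From the state `record` it checks that the input
consists of a word and its reversal, from all other states that the reversed word consists of the
symbols appended to the queue while the symbols of the word are removed. -/
noncomputable def sync : DPDA (SyncState P) (SyncLetter S) (SyncStack S) where
  bot := .bot
  δ q a y := match y with
    | .bot => syncBot p₀ u q a
    | .mark => syncTop B q a .mark
    | .sym y => syncTop B q a (.sym y)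
  bot_lowest q a y := by
    rcases y with _ | _ | y
    · cases q <;> cases a <;> simp [syncBot]
    · cases q <;> cases a <;> simp [syncTop]
    · cases q <;> cases a <;> simp [syncTop]
      split <;> simp

/-! ### From a synchronizing word to an emptying sequence -/

variable {B p₀ u}

theorem sync_run_done {w : List (SyncLetter S)} {y : SyncStack S} {υ : List (SyncStack S)}
    {d : SyncState P × List (SyncStack S)} (h : (sync B p₀ u).Run (.done, y :: υ) w d) :
    d.1 = .done := by
  induction w with
  | nil => rw [← run_nil_iff.1 h]
  | cons a w ih =>
    rw [run_cons_iff] at h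
    apply ih
    cases y <;> simpa [sync, syncBot, syncTop] using h

/-- Above `bot`, the trap never pops, so no further `reset` can take effect. At `bot` itself the
trap can be left, whence `hy`. -/
theorem sync_run_trap {w : List (SyncLetter S)} {y : SyncStack S} (hy : y ≠ .bot)
    {υ : List (SyncStack S)} {d : SyncState P × List (SyncStack S)}
    (h : (sync B p₀ u).Run (.trap, y :: υ) w d) : d.1 = .trap := by
  induction w with
  | nil => rw [← run_nil_iff.1 h]
  | cons a w ih =>
    rw [run_cons_iff] at h
    apply ih
    cases y
    · exact absurd rfl hy
    · simpa [sync, syncTop] using h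
    · simpa [sync, syncTop] using h

theorem sync_run_check {w : List (SyncLetter S)} {l : List S} {υ : List (SyncStack S)}
    (h : (sync B p₀ u).Run (.check, symStack l) w (.done, υ)) :
    ∃ r, w = l.map .read ++ .finish :: r := by
  induction l generalizing w with
  | nil =>
    cases w with
    | nil => simpa using run_nil_iff.1 h
    | cons a w =>
      rw [symStack, List.map_nil, List.nil_append, run_cons_iff] at h
      cases a with
      | finish => exact ⟨w, rfl⟩
      | _ => simpa using sync_run_trap (by simp) h
  | cons x l ih =>
    cases w with
    | nil => simpa using run_nil_iff.1 h
    | cons a w =>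
      rw [symStack, List.map_cons, List.cons_append, run_cons_iff] at h
      cases a with
      | read y =>
        by_cases hxy : y = x
        · subst hxy
          obtain ⟨r, rfl⟩ := ih (by simpa [sync, syncTop] using h)
          exact ⟨r, rfl⟩
        · simp only [sync, syncTop, if_neg hxy] at h
          simpa using sync_run_trap (by simp) h
      | _ => simpa using sync_run_trap (by simp) h

theorem symStack_eq_cons (l : List S) : ∃ y υ, symStack l = y :: υ ∧ y ≠ .bot := by
  cases l with
  | nil => exact ⟨_, _, rfl, by simp⟩
  | cons x l => exact ⟨_, _, rfl, by simp⟩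

theorem sync_δ_of_ne_bot {y : SyncStack S} (hy : y ≠ .bot) (q : SyncState P) (a : SyncLetter S) :
    (sync B p₀ u).δ q a y = syncTop B q a y := by
  cases y
  · exact absurd rfl hy
  · rfl
  · rfl

theorem sync_run_record {w : List (SyncLetter S)} {l : List S} {υ : List (SyncStack S)}
    (h : (sync B p₀ u).Run (.record, symStack l) w (.done, υ)) :
    ∃ (s : List S) (r : List (SyncLetter S)), w =
      s.map .read ++ .turn :: ((s.reverse ++ l).map .read ++ .finish :: r) := by
  induction w generalizing l with
  | nil => simpa using run_nil_iff.1 h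
  | cons a w ih =>
    obtain ⟨y, υ', hl, hy⟩ := symStack_eq_cons l
    rw [hl, run_cons_iff, sync_δ_of_ne_bot hy] at h
    cases a with
    | read x =>
      obtain ⟨s, r, rfl⟩ := ih (l := x :: l) (by simpa [syncTop, symStack, ← hl] using h)
      exact ⟨x :: s, r, by simp⟩
    | turn =>
      obtain ⟨r, rfl⟩ := sync_run_check (l := l) (by simpa [syncTop, ← hl] using h)
      exact ⟨[], r, by simp⟩
    | _ => simpa using sync_run_trap hy h

theorem sync_run_simulate {w : List (SyncLetter S)} {p : P} {l : List S}
    {υ : List (SyncStack S)}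
    (h : (sync B p₀ u).Run (.simulate p, symStack l) w (.done, υ)) :
    ∃ (s : List S) (r : List (SyncLetter S)), w =
      s.map .read ++ .turn :: (((B.out p s).reverse ++ l).map .read ++ .finish :: r) := by
  induction w generalizing l p with
  | nil => simpa using run_nil_iff.1 h
  | cons a w ih =>
    obtain ⟨y, υ', hl, hy⟩ := symStack_eq_cons l
    rw [hl, run_cons_iff, sync_δ_of_ne_bot hy] at h
    cases a with
    | read x =>
      obtain ⟨s, r, rfl⟩ := ih (p := (B.next p x).1) (l := (B.next p x).2.reverse ++ l)
        (by simpa [syncTop, symStack, ← hl] using h)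
      exact ⟨x :: s, r, by simp [QueueAutomaton.out]⟩
    | turn =>
      obtain ⟨r, rfl⟩ := sync_run_check (l := l) (by simpa [syncTop, ← hl] using h)
      exact ⟨[], r, by simp [QueueAutomaton.out]⟩
    | _ => simpa using sync_run_trap hy h

theorem map_read_append_inj {s s' : List S} {a a' : SyncLetter S} (ha : ∀ x, a ≠ .read x)
    (ha' : ∀ x, a' ≠ .read x) {t t' : List (SyncLetter S)}
    (h : s.map .read ++ a :: t = s'.map .read ++ a' :: t') : s = s' ∧ t = t' := by
  induction s generalizing s' with
  | nil =>
    cases s' with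
    | nil => simpa using (List.cons.inj h).2
    | cons x s' => exact absurd (List.cons.inj h).1 (ha x)
  | cons x s ih =>
    cases s' with
    | nil => exact absurd (List.cons.inj h).1.symm (ha' x)
    | cons y s' =>
      simp only [List.map_cons, List.cons_append, List.cons.injEq, SyncLetter.read.injEq] at h
      obtain ⟨rfl, rfl⟩ := ih h.2
      simp [h.1]

/-- Until the first `reset`, every letter leaves both configurations unchanged, so the two runs
leave the bottom on the same letter. -/
theorem sync_run_bot {w : List (SyncLetter S)} {υ υ' : List (SyncStack S)}
    (h : (sync B p₀ u).Run (.record, [.bot]) w (.done, υ))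
    (h' : (sync B p₀ u).Run (.simulate p₀, [.bot]) w (.done, υ')) :
    ∃ w', (sync B p₀ u).Run (.record, symStack []) w' (.done, υ) ∧
      (sync B p₀ u).Run (.simulate p₀, symStack u.reverse) w' (.done, υ') := by
  induction w with
  | nil => simpa using run_nil_iff.1 h
  | cons a w ih =>
    rw [run_cons_iff] at h h'
    cases a with
    | reset => exact ⟨w, by simpa [sync, syncBot] using h, by simpa [sync, syncBot] using h'⟩
    | _ => exact ih h h'

theorem exists_empties_of_isTurnSyncWord {n : ℕ} {m : StackModel} {w : List (SyncLetter S)}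
    (h : (sync B p₀ u).IsTurnSyncWord n m w) : ∃ s, B.Empties (p₀, u) s := by
  obtain ⟨p, υ, hr, -, -⟩ := h
  obtain rfl : p = .done := sync_run_done (hr .done)
  obtain ⟨w', h1, h2⟩ := sync_run_bot (hr .record) (hr (.simulate p₀))
  obtain ⟨s, r, e⟩ := sync_run_record h1
  obtain ⟨s', r', e'⟩ := sync_run_simulate h2
  -- Both parses describe the same word. The delimiter `turn` identifies the words read before it,
  -- and then `finish` identifies the words popped.
  obtain ⟨rfl, ht⟩ := map_read_append_inj (by simp) (by simp) (e.symm.trans e')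
  have := (map_read_append_inj (by simp) (by simp) ht).1
  refine ⟨s, ?_⟩
  have h3 := congrArg List.reverse this
  simpa [QueueAutomaton.Empties] using h3.symm

/-! ### From an emptying sequence to a one-turn synchronizing word -/

/-- The top symbol is always written back below the output, so the height does not drop even when
the output is empty. -/
theorem sync_upstroke_simulate (p : P) (l s : List S) :
    ∃ p', (sync B p₀ u).Upstroke (.simulate p, symStack l) (s.map .read)
      (.simulate p', symStack ((B.out p s).reverse ++ l)) := by
  induction s generalizing p l with
  | nil => exact ⟨p, RunWith.nil _⟩
  | cons x s ih =>
    obtain ⟨p', h⟩ := ih (B.next p x).1 ((B.next p x).2.reverse ++ l)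
    refine ⟨p', ?_⟩
    obtain ⟨y, υ, hl, hy⟩ := symStack_eq_cons l
    rw [hl]
    refine RunWith.cons_of_δ (sync_δ_of_ne_bot hy _ _) (by simp) ?_
    simpa [Upstroke, symStack, QueueAutomaton.out, ← hl] using h

theorem sync_upstroke_record (l s : List S) :
    (sync B p₀ u).Upstroke (.record, symStack l) (s.map .read)
      (.record, symStack (s.reverse ++ l)) := by
  induction s generalizing l with
  | nil => exact RunWith.nil _
  | cons x s ih =>
    obtain ⟨y, υ, hl, hy⟩ := symStack_eq_cons l
    rw [hl]
    refine RunWith.cons_of_δ (sync_δ_of_ne_bot hy _ _) (by simp) ?_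
    simpa [Upstroke, symStack, ← hl] using ih (x :: l)

theorem sync_upstroke_turn {q : SyncState P} (hq : ∀ y, syncTop B q .turn y = (.check, [y]))
    (l : List S) : (sync B p₀ u).Upstroke (q, symStack l) [.turn] (.check, symStack l) := by
  obtain ⟨y, υ, hl, hy⟩ := symStack_eq_cons l
  rw [hl]
  exact RunWith.cons_of_δ ((sync_δ_of_ne_bot hy _ _).trans (hq y)) (by simp) (.nil _)

theorem sync_downstroke_check (l : List S) :
    (sync B p₀ u).Downstroke (.check, symStack l) (l.map .read ++ [.finish]) (.done, [.bot]) := by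
  induction l with
  | nil => exact RunWith.cons_of_δ (q' := .done) (γ := []) rfl (by simp) (.nil _)
  | cons x l ih =>
    have hδ : (sync B p₀ u).δ .check (.read x) (.sym x) = (.check, []) := by simp [sync, syncTop]
    exact RunWith.cons_of_δ hδ (by simp) ih

theorem sync_downstroke_done (w : List (SyncLetter S)) :
    (sync B p₀ u).Downstroke (.done, [.bot]) w (.done, [.bot]) := by
  induction w with
  | nil => exact .nil _
  | cons a w ih =>
    have hδ : (sync B p₀ u).δ .done a .bot = (.done, [.bot]) := rfl
    exact RunWith.cons_of_δ hδ (by simp) ih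

/-- The synchronizing word given by a run of the queue automaton. -/
def syncWord (s : List S) : List (SyncLetter S) :=
  ((.reset :: s.map .read) ++ [.turn]) ++ (s.reverse.map .read ++ [.finish])

theorem sync_strokes_syncWord {s : List S} (hs : B.Empties (p₀, u) s) (q : SyncState P) :
    ∃ k ≤ 2, (sync B p₀ u).Strokes k (q, [.bot]) (syncWord s) (.done, [.bot]) := by
  have hsim : ∀ q : SyncState P, (sync B p₀ u).δ q .reset .bot =
      (.simulate p₀, symStack u.reverse) →
      ∃ k ≤ 2, (sync B p₀ u).Strokes k (q, [.bot]) (syncWord s) (.done, [.bot]) := by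
    intro q hq
    obtain ⟨p', h⟩ := sync_upstroke_simulate (B := B) (p₀ := p₀) (u := u) p₀ u.reverse s
    have he : (B.out p₀ s).reverse ++ u.reverse = s.reverse := by
      rw [← List.reverse_append]
      exact congrArg List.reverse hs
    rw [he] at h
    have h1 : (sync B p₀ u).Upstroke (q, [.bot]) (.reset :: s.map .read)
        (.simulate p', symStack s.reverse) :=
      RunWith.cons_of_δ hq (by simp) (by simpa [Upstroke] using h)
    exact ⟨2, le_rfl, strokes_two (h1.append (sync_upstroke_turn (fun _ => rfl) _))
      (sync_downstroke_check _)⟩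
  cases q with
  | done =>
    -- The sink never changes the height, so a single stroke suffices.
    refine ⟨1, one_le_two, ?_⟩
    have h := Strokes.succ (Or.inr (sync_downstroke_done (B := B) (p₀ := p₀) (u := u) (syncWord s)))
      (Strokes.zero _)
    rwa [List.append_nil] at h
  | record =>
    have h : (sync B p₀ u).Upstroke (.record, [.bot]) (.reset :: s.map .read)
        (.record, symStack s.reverse) :=
      RunWith.cons_of_δ (q' := .record) (γ := symStack []) rfl (by simp)
        (by simpa [Upstroke] using sync_upstroke_record (B := B) (p₀ := p₀) (u := u) [] s)
    exact ⟨2, le_rfl, strokes_two (h.append (sync_upstroke_turn (fun _ => rfl) _))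
      (sync_downstroke_check _)⟩
  | _ => exact hsim _ rfl

theorem isTurnSyncWord_syncWord {s : List S} (hs : B.Empties (p₀, u) s) (m : StackModel) :
    (sync B p₀ u).IsTurnSyncWord 1 m (syncWord s) := by
  refine ⟨.done, fun _ => [.bot], fun q => ?_, ?_, sync_strokes_syncWord hs⟩
  · obtain ⟨k, -, h⟩ := sync_strokes_syncWord hs q
    exact h.run
  · cases m
    · exact fun _ => rfl
    · exact fun _ _ => rfl
    · trivial

theorem exists_isTurnSyncWord_sync_iff (m : StackModel) :
    (∃ w, (sync B p₀ u).IsTurnSyncWord 1 m w) ↔ ∃ s, B.Empties (p₀, u) s :=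
  ⟨fun ⟨_, h⟩ => exists_empties_of_isTurnSyncWord h,
    fun ⟨_, h⟩ => ⟨_, isTurnSyncWord_syncWord h m⟩⟩

end Sync

end DPDA

/-! ### Invariance under renaming -/

namespace DPDA

section Transport

variable {Q A Γ Q' A' Γ' : Type}

/-- Renaming of the states, input letters and stack symbols of an automaton. -/
def mapEquiv (M : DPDA Q A Γ) (f : Q ≃ Q') (g : A ≃ A') (h : Γ ≃ Γ') : DPDA Q' A' Γ' where
  bot := h M.bot
  δ q a x := (f (M.δ (f.symm q) (g.symm a) (h.symm x)).1,
    (M.δ (f.symm q) (g.symm a) (h.symm x)).2.map h)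
  bot_lowest q a x hx := by
    have := M.bot_lowest (f.symm q) (g.symm a) (h.symm x) (by simpa using hx)
    refine ⟨by rw [← this.1]; simp, ?_⟩
    rw [List.map_dropLast.symm, List.mem_map_of_injective h.injective]
    exact this.2

variable {M : DPDA Q A Γ} (f : Q ≃ Q') (g : A ≃ A') (h : Γ ≃ Γ')

theorem mapEquiv_symm :
    (M.mapEquiv f g h).mapEquiv f.symm g.symm h.symm = M := by
  rcases M with ⟨b, δ, hb⟩
  simp [mapEquiv]

theorem RunWith.mapEquiv {R : ℕ → ℕ → Prop} {c d : Q × List Γ} {w : List A}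
    (hw : M.RunWith R c w d) :
    (M.mapEquiv f g h).RunWith R (c.map f (List.map h)) (w.map g) (d.map f (List.map h)) := by
  induction hw with
  | nil => exact .nil _
  | @cons c d e a w hs hR _ ih =>
    refine .cons ?_ (by simpa using hR) ih
    obtain ⟨q, _ | ⟨x, υ⟩⟩ := c
    · exact hs.elim
    · cases hs
      simp [Step, DPDA.mapEquiv]

theorem Strokes.mapEquiv {k : ℕ} {c d : Q × List Γ} {w : List A} (hw : M.Strokes k c w d) :
    (M.mapEquiv f g h).Strokes k (c.map f (List.map h)) (w.map g) (d.map f (List.map h)) := by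
  induction hw with
  | zero => exact .zero _
  | succ hs _ ih =>
    rw [List.map_append]
    exact .succ (hs.imp (RunWith.mapEquiv f g h) (RunWith.mapEquiv f g h)) ih

theorem IsTurnSyncWord.mapEquiv {n : ℕ} {m : StackModel} {w : List A}
    (hw : M.IsTurnSyncWord n m w) : (M.mapEquiv f g h).IsTurnSyncWord n m (w.map g) := by
  obtain ⟨p, υ, hr, hm, hs⟩ := hw
  refine ⟨f p, fun q => (υ (f.symm q)).map h, fun q => ?_, ?_, fun q => ?_⟩
  · have := RunWith.mapEquiv f g h (hr (f.symm q))
    rwa [Prod.map_apply, f.apply_symm_apply] at this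
  · cases m
    · exact fun q => congrArg (List.map h) (hm (f.symm q))
    · exact fun q q' => congrArg (List.map h) (hm (f.symm q) (f.symm q'))
    · trivial
  · obtain ⟨k, hk, hs⟩ := hs (f.symm q)
    have := hs.mapEquiv f g h
    rw [Prod.map_apply, f.apply_symm_apply] at this
    exact ⟨k, hk, this⟩

theorem exists_isTurnSyncWord_mapEquiv_iff {n : ℕ} {m : StackModel} :
    (∃ w, (M.mapEquiv f g h).IsTurnSyncWord n m w) ↔ ∃ w, M.IsTurnSyncWord n m w := by
  constructor
  · rintro ⟨w, hw⟩
    have := hw.mapEquiv f.symm g.symm h.symm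
    rw [mapEquiv_symm] at this
    exact ⟨_, this⟩
  · rintro ⟨w, hw⟩
    exact ⟨_, hw.mapEquiv f g h⟩

end Transport

/-! ### Computability of the reduction -/

/-- The word `u n` enters only the transitions on `reset` at the bottom; all others are constant in
`n`. -/
theorem primrec_sync_δ {P S : Type} (B : QueueAutomaton P S) (p₀ : P) {u : ℕ → List S}
    (hu : ∀ g : S → ℕ, Primrec fun n => (u n).map g) (q : SyncState P) (a : SyncLetter S)
    (y : SyncStack S) (f : SyncState P → ℕ) (h : SyncStack S → ℕ) :
    Primrec fun n => (f ((sync B p₀ (u n)).δ q a y).1, ((sync B p₀ (u n)).δ q a y).2.map h) := by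
  have hs : Primrec fun n => (f (.simulate p₀), (symStack (u n).reverse).map h) := by
    refine Primrec.pair (Primrec.const _) ((Primrec.list_append.comp
      (Primrec.list_reverse.comp (hu (h ∘ .sym))) (Primrec.const [h .mark, h .bot])).of_eq ?_)
    intro n
    simp
  have hc : (∀ n, (sync B p₀ (u n)).δ q a y = (sync B p₀ []).δ q a y) → Primrec fun n =>
      (f ((sync B p₀ (u n)).δ q a y).1, ((sync B p₀ (u n)).δ q a y).2.map h) :=
    fun he => (Primrec.const (f ((sync B p₀ []).δ q a y).1,
      ((sync B p₀ []).δ q a y).2.map h)).of_eq fun n => by rw [he n]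
  cases y with
  | bot =>
    cases a with
    | reset =>
      cases q with
      | done => exact hc fun _ => rfl
      | record => exact hc fun _ => rfl
      | _ => exact hs
    | _ => cases q <;> exact hc fun _ => rfl
  | _ => exact hc fun _ => rfl

end DPDA

namespace FinDPDA

/-- An automaton with finitely many states, letters and stack symbols, with these numbered. -/
noncomputable def ofDPDA {Q A Γ : Type} [Finite Q] [Finite A] [Finite Γ] [Nonempty Q]
    (M : DPDA Q A Γ) : FinDPDA where
  numStates := Nat.card Q
  numLetters := Nat.card A
  numStack := Nat.card Γ
  numStates_pos := Nat.card_pos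
  toDPDA := M.mapEquiv (Finite.equivFin Q) (Finite.equivFin A) (Finite.equivFin Γ)

theorem turnSync_ofDPDA_iff {Q A Γ : Type} [Finite Q] [Finite A] [Finite Γ] [Nonempty Q]
    (M : DPDA Q A Γ) (n : ℕ) (m : DPDA.StackModel) :
    TurnSync n m (ofDPDA M) ↔ ∃ w, M.IsTurnSyncWord n m w :=
  DPDA.exists_isTurnSyncWord_mapEquiv_iff _ _ _

/-- The sizes and the chosen numberings are the same for all `n`, so the noncomputable choices only
contribute constants to a table of fixed shape. -/
theorem primrec_code_sync {P S : Type} [Finite P] [Finite S] (B : QueueAutomaton P S) (p₀ : P)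
    {u : ℕ → List S} (hu : ∀ g : S → ℕ, Primrec fun n => (u n).map g) :
    Primrec fun n => (ofDPDA (DPDA.sync B p₀ (u n))).code := by
  let f := Finite.equivFin (DPDA.SyncState P)
  let g := Finite.equivFin (DPDA.SyncLetter S)
  let h := Finite.equivFin (DPDA.SyncStack S)
  have ht : Primrec fun n => List.ofFn fun q => List.ofFn fun a => List.ofFn fun x =>
      ((f ((DPDA.sync B p₀ (u n)).δ (f.symm q) (g.symm a) (h.symm x)).1 : ℕ),
        ((DPDA.sync B p₀ (u n)).δ (f.symm q) (g.symm a) (h.symm x)).2.map fun y => (h y : ℕ)) :=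
    Primrec.list_ofFn fun q => Primrec.list_ofFn fun a => Primrec.list_ofFn fun x =>
      DPDA.primrec_sync_δ B p₀ hu (f.symm q) (g.symm a) (h.symm x) (fun q => (f q : ℕ))
        (fun y => (h y : ℕ))
  refine ((Primrec.const (Nat.card (DPDA.SyncState P))).pair
    ((Primrec.const (Nat.card (DPDA.SyncLetter S))).pair
      ((Primrec.const (Nat.card (DPDA.SyncStack S))).pair
        ((Primrec.const (h .bot : ℕ)).pair ht)))).of_eq fun n => ?_
  simp only [code, ofDPDA, DPDA.mapEquiv, List.map_map, Function.comp_def]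
  rfl

/-- The one-turn synchronization problem is undecidable in each stack model. -/
theorem not_isDecidable_turnSync_one (m : DPDA.StackModel) :
    ¬ IsDecidable (TurnSync 1 m) := by
  rintro ⟨D, hD, hDM⟩
  obtain ⟨Γ, Λ, _, _, _, _, M, a, l, hl, hM⟩ := Turing.TM0.exists_undecidable_halting
  have hu : ∀ g : Turing.TM0.QSymbol Γ → ℕ,
      Primrec fun n => (Turing.TM0.queueOf [] (l n)).map g := by
    intro g
    refine (Primrec.list_cons.comp (Primrec.const (g .sep)) (Primrec.list_append.comp
      (hl (g ∘ .sym)) (Primrec.const [g .last]))).of_eq fun n => ?_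
    simp [Turing.TM0.queueOf]
  -- The initial state `.scan default a` is fixed because the first input cell `a` is; only the
  -- queue varies with `n`.
  refine hM (ComputablePred.computable_of_manyOneReducible
    ⟨_, (primrec_code_sync (Turing.TM0.queueAutomaton M) (.scan default a) hu).to_comp,
      fun n => ?_⟩ hD)
  rw [hDM, turnSync_ofDPDA_iff, DPDA.exists_isTurnSyncWord_sync_iff,
    Turing.TM0.exists_empties_iff]

end FinDPDA

theorem mainTheorem3 :
    ¬ FinDPDA.IsDecidable (FinDPDA.TurnSync 1 DPDA.StackModel.empty) ∧
    ¬ FinDPDA.IsDecidable (FinDPDA.TurnSync 1 DPDA.StackModel.same) ∧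
    ¬ FinDPDA.IsDecidable (FinDPDA.TurnSync 1 DPDA.StackModel.arbitrary) :=
  ⟨FinDPDA.not_isDecidable_turnSync_one _, FinDPDA.not_isDecidable_turnSync_one _,
    FinDPDA.not_isDecidable_turnSync_one _⟩
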